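/- **Conventions.** All vector spaces are over $\mathbb{C}$. A vertex superalgebra is a super vector space $V=V_0\oplus V_1$ with an even vacuum vector $\mathbf 1$ and fields $a(z)=\sum_{n\in\mathbb{Z}}a_{(n)}z^{-n-1}$, $a\in V$, satisfying the vacuum axioms and the Borcherds (Jacobi) identity; its Wick product is $:\!ab\!:\,=a_{(-1)}b$, and $\partial a=a_{(-2)}\mathbf 1$. A vertex operator superalgebra is a vertex superalgebra with an even Virasoro vector $L(z)=\sum_n L_nz^{-n-2}$ of some central charge such that $L_{-1}=\partial$ and $L_0$ is diagonalizable. A vector $a$ has weight $d$ if $L_0a=da$, and is primary of weight $d$ if moreover $L_na=0$ for all $n>0$. A topological vertex operator algebra (TVOA) is a vertex operator superalgebra $C^*$ with - an even weight one field $F(z)=\sum_n F_nz^{-n-1}$ whose charge $F_0$ is the fermion number operator: $C^*=\bigoplus_{p\in\mathbb{Z}}C^p$ with $C^p=\ker(F_0-p)$, and the parity is $p$ mod $2$ on $C^p$; - an odd primary field $J(z)=\sum_nJ_nz^{-n-1}$ of weight one and fermion number $1$, whose charge $Q=J_0$ satisfies $Q^2=0$; - an odd primary field $G(z)=\sum_nG_nz^{-n-2}$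 of weight two and fermion number $-1$ with $[Q,G(z)]=L(z)$ (supercommutator). Let $H^*=H^*(C)=\ker Q/\operatorname{im}Q=\bigoplus_pH^p$ be the cohomology of $(C^*,Q)$, graded by fermion number; write $|u|=p$ for $u\in H^p$. **Theorem.** Let $C^*$ be a TVOA. 1. The Wick product of closed vectors is closed and descends to a product on $H^*$ which is graded, associative, supercommutative ($u\cdot v=(-1)^{|u||v|}v\cdot u$) and unital with unit the class of $\mathbf 1$. 2. Every class in $H^*$ has a closed representative $u$ with $L_0u=0$; for such $u$ the vector $G_0u$ is closed, and $[u]\mapsto[G_0u]$ is a well-defined linear operator on $H^*$, again denoted $G_0$. It is a BV operator: it has degree $-1$, $G_0^2=0$, and it is a second order differential operator, i.e. for homogeneous $u,v$ and all $t$ $$G_0(uvt)=G_0(uv)t+(-1)^{|u|}u\,G_0(vt)+(-1)^{(|u|-1)|v|}v\,G_0(ut)-(G_0u)vt-(-1)^{|u|}u(G_0v)t-(-1)^{|u|+|v|}uv\,G_0t.$$ 3. The bilinear bracket measuring the failure of $G_0$ to be a derivation, $$\{u,v\}:=(-1)^{|u|}\bigl(G_0(u\cdot v)-(G_0u)\cdot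 v-(-1)^{|u|}u\cdot(G_0v)\bigr),$$ is a Gerstenhaber (odd Poisson) bracket $H^p\times H^q\to H^{p+q-1}$: for homogeneous $u,v,t$, - $\{u,v\}=-(-1)^{(|u|-1)(|v|-1)}\{v,u\}$, - $(-1)^{(|u|-1)(|t|-1)}\{u,\{v,t\}\}+(-1)^{(|t|-1)(|v|-1)}\{t,\{u,v\}\}+(-1)^{(|v|-1)(|u|-1)}\{v,\{t,u\}\}=0$, - $\{u,v\cdot t\}=\{u,v\}\cdot t+(-1)^{(|u|-1)|v|}v\cdot\{u,t\}$, - $G_0\{u,v\}=\{G_0u,v\}+(-1)^{|u|-1}\{u,G_0v\}$. 4. In particular $H^0$ is a commutative algebra under the product, and $H^1$ is a Lie algebra with Lie bracket $\{\,,\}$. -/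

import Mathlib

universe u

noncomputable section

/-- The Koszul sign `(-1)^{ij}` of two parities. -/
def koszulSign (i j : ZMod 2) : ℂ := (-1) ^ (i.val * j.val)

/-- A vertex superalgebra over `ℂ`: a super vector space `V = V₀ ⊕ V₁`, an even state-field
correspondence `Y(a, z) = ∑ₙ a₍ₙ₎ z^{-n-1}` and an even vacuum vector, subject to the vacuum axioms
and the Borcherds (Jacobi) identity. As `VertexOperator ℂ V` consists of the linear maps
`V → V((z))`, one has `a₍ₙ₎ b = 0` for `n ≫ 0`, so all sums below are finite. -/
structure VertexSuperalgebra (V : Type*) [AddCommGroup V] [Module ℂ V] where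
  /-- the even part `parity 0` and the odd part `parity 1` -/
  parity : ZMod 2 → Submodule ℂ V
  parity_isInternal : DirectSum.IsInternal parity
  /-- the field `a(z)` of a state `a` -/
  Y : V →ₗ[ℂ] VertexOperator ℂ V
  /-- the vacuum -/
  vac : V
  vac_even : vac ∈ parity 0
  parity_mode : ∀ (i j : ZMod 2) (a b : V) (n : ℤ), a ∈ parity i → b ∈ parity j →
    (Y a).ncoeff n b ∈ parity (i + j)
  /-- `Y(1, z) = id` -/
  vac_mode : ∀ (n : ℤ) (b : V), (Y vac).ncoeff n b = if n = -1 then b else 0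
  /-- `Y(a, z) 1 ∈ a + z V[[z]]` -/
  mode_vac_nonneg : ∀ (a : V) (n : ℤ), 0 ≤ n → (Y a).ncoeff n vac = 0
  mode_vac_neg_one : ∀ a : V, (Y a).ncoeff (-1) vac = a
  borcherds : ∀ (i j : ZMod 2) (a b c : V) (m n k : ℤ), a ∈ parity i → b ∈ parity j →
    ∑ᶠ r : ℕ, (Ring.choose m r : ℤ) •
        (Y ((Y a).ncoeff (n + r) b)).ncoeff (m + k - r) c =
      ∑ᶠ r : ℕ, ((-1) ^ r * Ring.choose n r : ℤ) •
        ((Y a).ncoeff (m + n - r) ((Y b).ncoeff (k + r) c)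
          - (koszulSign i j * (-1) ^ n) •
            (Y b).ncoeff (n + k - r) ((Y a).ncoeff (m + r) c))

namespace VertexSuperalgebra

variable {V : Type*} [AddCommGroup V] [Module ℂ V] (A : VertexSuperalgebra V)

/-- The Fourier mode `a₍ₙ₎`, where `a(z) = ∑ₙ a₍ₙ₎ z^{-n-1}`. -/
def mode (a : V) (n : ℤ) : Module.End ℂ V := (A.Y a).ncoeff n

/-- The Wick (normally ordered) product `:ab: = a₍₋₁₎ b`. -/
def wick (a b : V) : V := A.mode a (-1) b

/-- The translation operator `∂a = a₍₋₂₎ 1`. -/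
def translation (a : V) : V := A.mode a (-2) A.vac

end VertexSuperalgebra

/-- A vertex operator superalgebra: a vertex superalgebra with a conformal structure, i.e. an even
Virasoro vector `L` of some central charge `c`, `L(z) = ∑ₙ Lₙ z^{-n-2}`, such that `L₋₁ = ∂` and
`L₀` is diagonalizable. -/
structure VertexOperatorSuperalgebra (V : Type*) [AddCommGroup V] [Module ℂ V] extends
    VertexSuperalgebra V where
  /-- the Virasoro vector -/
  L : V
  /-- the central charge -/
  c : ℂ
  L_even : L ∈ parity 0
  /-- the operator product expansion
  `L(z)L(w) ∼ (c/2)(z-w)⁻⁴ + 2L(w)(z-w)⁻² + ∂L(w)(z-w)⁻¹` -/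
  L_ope_zero : toVertexSuperalgebra.mode L 0 L = toVertexSuperalgebra.translation L
  L_ope_one : toVertexSuperalgebra.mode L 1 L = (2 : ℂ) • L
  L_ope_two : toVertexSuperalgebra.mode L 2 L = 0
  L_ope_three : toVertexSuperalgebra.mode L 3 L = (c / 2) • vac
  L_ope_ge : ∀ n : ℤ, 4 ≤ n → toVertexSuperalgebra.mode L n L = 0
  L_neg_one : ∀ a : V, toVertexSuperalgebra.mode L 0 a = toVertexSuperalgebra.translation a
  L_zero_diagonalizable :
    ⨆ d : ℂ, Module.End.eigenspace (toVertexSuperalgebra.mode L 1) d = ⊤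

namespace VertexOperatorSuperalgebra

variable {V : Type*} [AddCommGroup V] [Module ℂ V] (A : VertexOperatorSuperalgebra V)

/-- The Virasoro operator `Lₙ = L₍ₙ₊₁₎`. -/
def virasoro (n : ℤ) : Module.End ℂ V := A.mode A.L (n + 1)

/-- `a` has conformal weight `d`. -/
def HasWeight (a : V) (d : ℂ) : Prop := A.virasoro 0 a = d • a

/-- `a` is primary of conformal weight `d`. -/
def IsPrimary (a : V) (d : ℂ) : Prop :=
  A.HasWeight a d ∧ ∀ n : ℤ, 0 < n → A.virasoro n a = 0

end VertexOperatorSuperalgebra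

/-- A topological vertex operator algebra `(C^*, F, J, G)`. -/
structure TopologicalVOA (V : Type*) [AddCommGroup V] [Module ℂ V] extends
    VertexOperatorSuperalgebra V where
  /-- the fermion number current -/
  F : V
  /-- the current whose charge is the differential -/
  J : V
  /-- the superpartner of the Virasoro element -/
  G : V
  F_even : F ∈ parity 0
  F_weight : toVertexOperatorSuperalgebra.HasWeight F 1
  /-- The charge `F₀ = F₍₀₎` is a fermion number operator: it is diagonalizable with integral
  eigenvalues, and the parity is the fermion number modulo 2. -/
  fermion_span : ⨆ p : ℤ,
    Module.End.eigenspace (toVertexSuperalgebra.mode F 0) (p : ℂ) = ⊤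
  fermion_parity : ∀ p : ℤ,
    Module.End.eigenspace (toVertexSuperalgebra.mode F 0) (p : ℂ) ≤ parity (p : ZMod 2)
  J_odd : J ∈ parity 1
  J_primary : toVertexOperatorSuperalgebra.IsPrimary J 1
  J_fermion : toVertexSuperalgebra.mode F 0 J = J
  /-- the charge `Q = J₀ = J₍₀₎` has square zero -/
  Q_sq : ∀ v : V, toVertexSuperalgebra.mode J 0 (toVertexSuperalgebra.mode J 0 v) = 0
  G_odd : G ∈ parity 1
  G_primary : toVertexOperatorSuperalgebra.IsPrimary G 2
  G_fermion : toVertexSuperalgebra.mode F 0 G = -G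
  /-- `[Q, G(z)] = L(z)`; this is an anticommutator, as both `Q` and `G` are odd -/
  Q_G : ∀ (n : ℤ) (v : V),
    toVertexSuperalgebra.mode J 0 (toVertexSuperalgebra.mode G n v)
      + toVertexSuperalgebra.mode G n (toVertexSuperalgebra.mode J 0 v)
      = toVertexSuperalgebra.mode L n v

namespace TopologicalVOA

variable {V : Type*} [AddCommGroup V] [Module ℂ V] (C : TopologicalVOA V)

/-- The differential `Q = J₀`, where `J(z) = ∑ₙ Jₙ z^{-n-1}`. -/
def Q : Module.End ℂ V := C.mode C.J 0

/-- The zero mode `G₀ = G₍₁₎`, where `G(z) = ∑ₙ Gₙ z^{-n-2}`. -/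
def G₀ : Module.End ℂ V := C.mode C.G 1

/-- The Virasoro operator `L₀`. -/
def L₀ : Module.End ℂ V := C.virasoro 0

/-- The space `C^p` of vectors of fermion number `p`. -/
def fermion (p : ℤ) : Submodule ℂ V := Module.End.eigenspace (C.mode C.F 0) (p : ℂ)

/-- The (total) cohomology `H^*(C) = ker Q / im Q`. -/
abbrev Cohomology : Type _ :=
  LinearMap.ker C.Q ⧸ (LinearMap.range C.Q).submoduleOf (LinearMap.ker C.Q)

/-- The cohomology class of a closed vector. -/
def cls (u : V) (hu : C.Q u = 0) : C.Cohomology :=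
  Submodule.Quotient.mk ⟨u, LinearMap.mem_ker.mpr hu⟩

/-- `H^p(C) ⊆ H^*(C)`: the classes of closed vectors of fermion number `p`. -/
def H (p : ℤ) : Submodule ℂ C.Cohomology :=
  ((C.fermion p).submoduleOf (LinearMap.ker C.Q)).map
    ((LinearMap.range C.Q).submoduleOf (LinearMap.ker C.Q)).mkQ

end TopologicalVOA

section BV

variable {H : Type*} [AddCommGroup H] [Module ℂ H]

/-- `mul` is a supercommutative associative product with unit `e` on the `ℤ`-graded vector space
`H = ⨁ H^p`. -/
structure IsSupercommutative (gr : ℤ → Submodule ℂ H) (mul : H →ₗ[ℂ] H →ₗ[ℂ] H) (e : H) :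
    Prop where
  mul_mem : ∀ (p q : ℤ) (u v : H), u ∈ gr p → v ∈ gr q → mul u v ∈ gr (p + q)
  unit_mem : e ∈ gr 0
  unit_mul : ∀ u, mul e u = u
  mul_unit : ∀ u, mul u e = u
  assoc : ∀ u v t, mul (mul u v) t = mul u (mul v t)
  comm : ∀ (p q : ℤ) (u v : H), u ∈ gr p → v ∈ gr q →
    mul u v = (-1 : ℂ) ^ (p * q) • mul v u

/-- `Δ` is a BV operator: it has degree `-1`, square zero, and is a second order differential
operator for the product `mul`. -/
structure IsBVOperator (gr : ℤ → Submodule ℂ H) (mul : H →ₗ[ℂ] H →ₗ[ℂ] H) (Δ : H →ₗ[ℂ] H) :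
    Prop where
  degree : ∀ (p : ℤ) (u : H), u ∈ gr p → Δ u ∈ gr (p - 1)
  square : ∀ u, Δ (Δ u) = 0
  second_order : ∀ (p q : ℤ) (u v t : H), u ∈ gr p → v ∈ gr q →
    Δ (mul (mul u v) t) =
      mul (Δ (mul u v)) t + (-1 : ℂ) ^ p • mul u (Δ (mul v t))
        + (-1 : ℂ) ^ ((p - 1) * q) • mul v (Δ (mul u t))
        - mul (mul (Δ u) v) t - (-1 : ℂ) ^ p • mul (mul u (Δ v)) t
        - (-1 : ℂ) ^ (p + q) • mul (mul u v) (Δ t)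

/-- `br` is a Gerstenhaber (odd Poisson) bracket of degree `-1` for the product `mul`. -/
structure IsGerstenhaberBracket (gr : ℤ → Submodule ℂ H) (mul br : H →ₗ[ℂ] H →ₗ[ℂ] H) :
    Prop where
  degree : ∀ (p q : ℤ) (u v : H), u ∈ gr p → v ∈ gr q → br u v ∈ gr (p + q - 1)
  skew : ∀ (p q : ℤ) (u v : H), u ∈ gr p → v ∈ gr q →
    br u v = -((-1 : ℂ) ^ ((p - 1) * (q - 1)) • br v u)
  jacobi : ∀ (p q r : ℤ) (u v t : H), u ∈ gr p → v ∈ gr q → t ∈ gr r →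
    (-1 : ℂ) ^ ((p - 1) * (r - 1)) • br u (br v t)
      + (-1 : ℂ) ^ ((r - 1) * (q - 1)) • br t (br u v)
      + (-1 : ℂ) ^ ((q - 1) * (p - 1)) • br v (br t u) = 0
  leibniz : ∀ (p q : ℤ) (u v t : H), u ∈ gr p → v ∈ gr q →
    br u (mul v t) = mul (br u v) t + (-1 : ℂ) ^ ((p - 1) * q) • mul v (br u t)

end BV

end

/-! The charge `Q` is a superderivation of every product `a₍ₙ₎b`, so all these products descend to
cohomology. Translation is `[Q, G₍₀₎]`, hence exact on closed vectors; as `(∂a)₍ₙ₊₁₎ = -(n+1) a₍ₙ₎`,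
only `a₍₋₁₎` survives on cohomology (`mode_mem_range`). The Borcherds identity then collapses to
supercommutativity and associativity of the Wick product.

Likewise `L₀ = [Q, G₀]`, so nonzero weights are acyclic, and on closed vectors of weight zero `G₀`
preserves closedness. Its square is exact because `2 G₀²` is a sum of modes, of index other than
`-1`, of closed vectors (`G₀_G₀_mem_range`). Its failure to be a derivation is the operator
`(G₍₀₎u)₍₀₎` (`bvDefect_cls`), and a zero mode is a superderivation of the Wick product
(`bvDefect_leibniz`).

The rest is formal: in a supercommutative algebra, an operator of degree `-1` and square zero whose
defect obeys the Leibniz rule is a BV operator, and its defect is, up to sign, a Gerstenhaber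
bracket. -/

section LinearAlgebra

/-! ### Diagonal operators and extension from graded pieces -/

variable {M : Type*} [AddCommGroup M] [Module ℂ M]

lemma exists_diagonal {ι : Type*} {gr : ι → Submodule ℂ M} (hind : iSupIndep gr)
    (htop : iSup gr = ⊤) (c : ι → ℂ) :
    ∃ T : M →ₗ[ℂ] M, ∀ i, ∀ x ∈ gr i, T x = c i • x := by
  classical
  have hint : DirectSum.IsInternal gr :=
    (DirectSum.isInternal_submodule_iff_iSupIndep_and_iSup_eq_top gr).2 ⟨hind, htop⟩
  let e := LinearEquiv.ofBijective (DirectSum.coeLinearMap gr) hint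
  refine ⟨DirectSum.toModule ℂ ι M (fun i => c i • (gr i).subtype) ∘ₗ e.symm.toLinearMap,
    fun i x hx => ?_⟩
  have : e.symm x = DirectSum.lof ℂ ι (fun i => gr i) i ⟨x, hx⟩ := by
    rw [LinearEquiv.symm_apply_eq]
    exact (DirectSum.coeLinearMap_lof gr i ⟨x, hx⟩).symm
  simp [this]

lemma linearMap_ext_of_iSup {N : Type*} [AddCommGroup N] [Module ℂ N] {ι : Type*}
    {gr : ι → Submodule ℂ M} (htop : iSup gr = ⊤) {f g : M →ₗ[ℂ] N}
    (h : ∀ i, ∀ x ∈ gr i, f x = g x) : f = g := by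
  ext x
  have hx : x ∈ iSup gr := htop ▸ Submodule.mem_top
  induction hx using Submodule.iSup_induction' with
  | mem i x hx => exact h i x hx
  | zero => simp
  | add x y _ _ hx hy => simp [hx, hy]

lemma commute_of_eigenspaces {A f T : M →ₗ[ℂ] M} {c : ℂ → ℂ}
    (htop : ⨆ d : ℂ, Module.End.eigenspace A d = ⊤)
    (hT : ∀ d, ∀ x ∈ Module.End.eigenspace A d, T x = c d • x)
    (hf : ∀ x, A (f x) = f (A x)) (x : M) : T (f x) = f (T x) := by
  have : T ∘ₗ f = f ∘ₗ T := linearMap_ext_of_iSup htop fun d x hx => by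
    have hfx : f x ∈ Module.End.eigenspace A d := by
      rw [Module.End.mem_eigenspace_iff] at hx ⊢
      rw [hf, hx, map_smul]
    simp [hT d x hx, hT d _ hfx]
  exact LinearMap.congr_fun this x

end LinearAlgebra

/-! ### BV operators and Gerstenhaber brackets on a graded algebra -/

section BVAlgebra

variable {H : Type*} [AddCommGroup H] [Module ℂ H] {gr : ℤ → Submodule ℂ H}
  {mul : H →ₗ[ℂ] H →ₗ[ℂ] H} {e : H} {Δ : H →ₗ[ℂ] H}

/-- The failure of `Δ` to commute with the multiplication by an element `u` of degree `p`, up to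
the multiplication by `Δ u`. -/
noncomputable def bvDefect (mul : H →ₗ[ℂ] H →ₗ[ℂ] H) (Δ : H →ₗ[ℂ] H) (p : ℤ) (u v : H) : H :=
  Δ (mul u v) - mul (Δ u) v - (-1 : ℂ) ^ p • mul u (Δ v)

/-- The second order identity is the Leibniz rule of the defect written out, once supercommutativity
has reordered `v·Δu·t` and `v·u·Δt`. -/
lemma isBVOperator_of_leibniz (hm : IsSupercommutative gr mul e)
    (hdeg : ∀ (p : ℤ) (u : H), u ∈ gr p → Δ u ∈ gr (p - 1)) (hsq : ∀ u, Δ (Δ u) = 0)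
    (hleib : ∀ (p q : ℤ) (u v t : H), u ∈ gr p → v ∈ gr q → bvDefect mul Δ p u (mul v t) =
      mul (bvDefect mul Δ p u v) t + (-1 : ℂ) ^ ((p - 1) * q) • mul v (bvDefect mul Δ p u t)) :
    IsBVOperator gr mul Δ where
  degree := hdeg
  square := hsq
  second_order p q u v t hu hv := by
    have h := hleib p q u v t hu hv
    have h1 : mul (mul v (Δ u)) t = (-1 : ℂ) ^ (q * (p - 1)) • mul (mul (Δ u) v) t := by
      rw [hm.comm q (p - 1) v (Δ u) hv (hdeg p u hu)]; simp
    have h2 : mul (mul v u) (Δ t) = (-1 : ℂ) ^ (q * p) • mul (mul u v) (Δ t) := by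
      rw [hm.comm q p v u hv hu]; simp
    simp only [bvDefect, map_sub, map_smul, LinearMap.sub_apply, LinearMap.smul_apply,
      ← hm.assoc] at h
    rw [h1, h2, sub_sub, sub_eq_iff_eq_add] at h
    rw [h]
    -- The signs depend only on the parities of `p` and `q`; each of the four cases is a linear
    -- identity.
    simp only [hm.assoc, neg_one_zpow_eq_ite, Int.even_add, Int.even_sub, Int.even_mul,
      Int.not_even_one]
    by_cases hp : Even p <;> by_cases hq : Even q <;> simp [hp, hq] <;> module

lemma bvDefect_mem (hm : IsSupercommutative gr mul e)
    (hdeg : ∀ (p : ℤ) (u : H), u ∈ gr p → Δ u ∈ gr (p - 1)) {p q : ℤ} {u v : H}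
    (hu : u ∈ gr p) (hv : v ∈ gr q) : bvDefect mul Δ p u v ∈ gr (p + q - 1) := by
  refine sub_mem (sub_mem (hdeg _ _ (hm.mul_mem p q u v hu hv)) ?_) (Submodule.smul_mem _ _ ?_)
  · convert hm.mul_mem _ _ _ _ (hdeg p u hu) hv using 2; ring
  · convert hm.mul_mem _ _ _ _ hu (hdeg q v hv) using 2; ring

lemma bvDefect_comm (hm : IsSupercommutative gr mul e)
    (hdeg : ∀ (p : ℤ) (u : H), u ∈ gr p → Δ u ∈ gr (p - 1)) {p q : ℤ} {u v : H}
    (hu : u ∈ gr p) (hv : v ∈ gr q) :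
    bvDefect mul Δ p u v = (-1 : ℂ) ^ (p * q) • bvDefect mul Δ q v u := by
  simp only [bvDefect]
  rw [hm.comm p q u v hu hv, hm.comm _ _ _ _ (hdeg p u hu) hv,
    hm.comm _ _ _ _ hu (hdeg q v hv)]
  simp only [map_smul, neg_one_zpow_eq_ite, Int.even_sub, Int.even_mul, Int.not_even_one]
  by_cases hp : Even p <;> by_cases hq : Even q <;> simp [hp, hq] <;> module

/-- `Δ² = 0` leaves only `Δ(Δu·v)` and `Δ(u·Δv)`, the leading terms of the two defects on the right,
whose `Δu·Δv` terms cancel. -/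
lemma map_bvDefect (hsq : ∀ u, Δ (Δ u) = 0) (p : ℤ) (u v : H) :
    Δ (bvDefect mul Δ p u v) =
      -bvDefect mul Δ (p - 1) (Δ u) v - (-1 : ℂ) ^ p • bvDefect mul Δ p u (Δ v) := by
  simp only [bvDefect, map_sub, map_smul, hsq, map_zero, LinearMap.zero_apply,
    neg_one_zpow_eq_ite, Int.even_sub, Int.not_even_one]
  by_cases hp : Even p <;> simp [hp] <;> module

lemma bvDefect_add (p : ℤ) (u v w : H) :
    bvDefect mul Δ p u (v + w) = bvDefect mul Δ p u v + bvDefect mul Δ p u w := by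
  simp only [bvDefect, map_add]; module

lemma bvDefect_smul (p : ℤ) (u v : H) (c : ℂ) :
    bvDefect mul Δ p u (c • v) = c • bvDefect mul Δ p u v := by
  simp only [bvDefect, map_smul]; module

/-- The Jacobi identity in derivation form, up to the signs relating `bvDefect` to the bracket. -/
lemma bvDefect_jacobi (hdeg : ∀ (p : ℤ) (u : H), u ∈ gr p → Δ u ∈ gr (p - 1))
    (hsq : ∀ u, Δ (Δ u) = 0)
    (hleib : ∀ (p q : ℤ) (u v t : H), u ∈ gr p → v ∈ gr q → bvDefect mul Δ p u (mul v t) =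
      mul (bvDefect mul Δ p u v) t + (-1 : ℂ) ^ ((p - 1) * q) • mul v (bvDefect mul Δ p u t))
    {p q : ℤ} {u v : H} (hu : u ∈ gr p) (hv : v ∈ gr q) (t : H) :
    bvDefect mul Δ p u (bvDefect mul Δ q v t) =
      (-1 : ℂ) ^ (p - 1) • bvDefect mul Δ (p + q - 1) (bvDefect mul Δ p u v) t
        + (-1 : ℂ) ^ ((p - 1) * (q - 1)) • bvDefect mul Δ q v (bvDefect mul Δ p u t) := by
  -- Moves the operator `D_u = bvDefect mul Δ p u` past `Δ`, at the cost of a term in `D_{Δu}`.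
  have comm : ∀ w, bvDefect mul Δ p u (Δ w) = -(-1 : ℂ) ^ p •
      (Δ (bvDefect mul Δ p u w) + bvDefect mul Δ (p - 1) (Δ u) w) := fun w => by
    rw [map_bvDefect hsq]
    simp only [neg_one_zpow_eq_ite]
    by_cases hp : Even p <;> simp [hp]
  have expand : ∀ w, bvDefect mul Δ q v w =
      Δ (mul v w) + ((-1 : ℂ) • mul (Δ v) w + (-(-1 : ℂ) ^ q) • mul v (Δ w)) := fun w => by
    simp only [bvDefect]; module
  -- The terms in `D_{Δu}` cancel because `D_{Δu}` obeys the Leibniz rule too, which is `h2`.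
  have h1 := hleib p q u v t hu hv
  have h2 := hleib (p - 1) q (Δ u) v t (hdeg p u hu) hv
  have h3 := hleib p (q - 1) u (Δ v) t hu (hdeg q v hv)
  have h4 := hleib p q u v (Δ t) hu hv
  rw [expand t, expand (bvDefect mul Δ p u t), bvDefect_add, bvDefect_add, bvDefect_smul,
    bvDefect_smul, h3, h4, comm, comm, comm, h1, h2]
  rw [show bvDefect mul Δ (p + q - 1) (bvDefect mul Δ p u v) t =
    Δ (mul (bvDefect mul Δ p u v) t) - mul (Δ (bvDefect mul Δ p u v)) t
      - (-1 : ℂ) ^ (p + q - 1) • mul (bvDefect mul Δ p u v) (Δ t) from rfl]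
  simp only [map_add, map_smul, LinearMap.add_apply, LinearMap.smul_apply,
    neg_one_zpow_eq_ite, Int.even_add, Int.even_sub, Int.even_mul, Int.not_even_one]
  by_cases hp : Even p <;> by_cases hq : Even q <;> simp [hp, hq] <;> module

lemma isGerstenhaberBracket_of_leibniz (hm : IsSupercommutative gr mul e)
    (hdeg : ∀ (p : ℤ) (u : H), u ∈ gr p → Δ u ∈ gr (p - 1)) (hsq : ∀ u, Δ (Δ u) = 0)
    (hleib : ∀ (p q : ℤ) (u v t : H), u ∈ gr p → v ∈ gr q → bvDefect mul Δ p u (mul v t) =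
      mul (bvDefect mul Δ p u v) t + (-1 : ℂ) ^ ((p - 1) * q) • mul v (bvDefect mul Δ p u t))
    {br : H →ₗ[ℂ] H →ₗ[ℂ] H}
    (hbr : ∀ (p : ℤ) (u v : H), u ∈ gr p → br u v = (-1 : ℂ) ^ p • bvDefect mul Δ p u v) :
    IsGerstenhaberBracket gr mul br := by
  have degree : ∀ (p q : ℤ) (u v : H), u ∈ gr p → v ∈ gr q → br u v ∈ gr (p + q - 1) := by
    intro p q u v hu hv
    rw [hbr p u v hu]
    exact Submodule.smul_mem _ _ (bvDefect_mem hm hdeg hu hv)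
  have skew : ∀ (p q : ℤ) (u v : H), u ∈ gr p → v ∈ gr q →
      br u v = -((-1 : ℂ) ^ ((p - 1) * (q - 1)) • br v u) := by
    intro p q u v hu hv
    rw [hbr p u v hu, hbr q v u hv, bvDefect_comm hm hdeg hu hv]
    simp only [neg_one_zpow_eq_ite, Int.even_sub, Int.even_mul, Int.not_even_one]
    by_cases hp : Even p <;> by_cases hq : Even q <;> simp [hp, hq]
  refine ⟨degree, skew, fun p q r u v t hu hv ht => ?_, fun p q u v t hu hv => ?_⟩
  -- Jacobi in derivation form; skew symmetry then turns it into the cyclic form.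
  · have h1 : br u (br v t) =
        br (br u v) t + (-1 : ℂ) ^ ((p - 1) * (q - 1)) • br v (br u t) := by
      rw [hbr _ _ (br v t) hu, hbr _ _ t hv, hbr _ _ (br u t) hv, hbr _ _ t hu,
        hbr _ _ t (degree p q u v hu hv), hbr p u v hu, bvDefect_smul, bvDefect_smul,
        bvDefect_jacobi hdeg hsq hleib hu hv]
      have : ∀ (c : ℂ) (w : H), bvDefect mul Δ (p + q - 1) (c • w) t =
          c • bvDefect mul Δ (p + q - 1) w t := fun c w => by
        simp only [bvDefect, map_smul, LinearMap.smul_apply]; module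
      rw [this]
      simp only [neg_one_zpow_eq_ite, Int.even_add, Int.even_sub, Int.even_mul, Int.not_even_one]
      by_cases hp : Even p <;> by_cases hq : Even q <;> simp [hp, hq]
    rw [h1, skew _ _ t (br u v) ht (degree p q u v hu hv), skew _ _ t u ht hu]
    simp only [map_neg, map_smul, neg_one_zpow_eq_ite, Int.even_add, Int.even_sub, Int.even_mul,
      Int.not_even_one]
    by_cases hp : Even p <;> by_cases hq : Even q <;> by_cases hr : Even r <;>
      simp [hp, hq, hr]
  · rw [hbr p u _ hu, hbr p u _ hu, hbr p u _ hu, hleib p q u v t hu hv]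
    simp only [map_smul, LinearMap.smul_apply]
    module

lemma map_bracket_of_bvDefect
    (hdeg : ∀ (p : ℤ) (u : H), u ∈ gr p → Δ u ∈ gr (p - 1)) (hsq : ∀ u, Δ (Δ u) = 0)
    {br : H →ₗ[ℂ] H →ₗ[ℂ] H}
    (hbr : ∀ (p : ℤ) (u v : H), u ∈ gr p → br u v = (-1 : ℂ) ^ p • bvDefect mul Δ p u v)
    (p : ℤ) (u v : H) (hu : u ∈ gr p) :
    Δ (br u v) = br (Δ u) v + (-1 : ℂ) ^ (p - 1) • br u (Δ v) := by
  rw [hbr p u v hu, hbr _ _ v (hdeg p u hu), hbr p u _ hu, map_smul, map_bvDefect hsq]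
  simp only [neg_one_zpow_eq_ite, Int.even_sub, Int.not_even_one]
  by_cases hp : Even p <;> simp [hp] <;> module

/-- The bilinear bracket of a BV operator. -/
lemma exists_bvBracket (hind : iSupIndep gr) (htop : iSup gr = ⊤) (mul : H →ₗ[ℂ] H →ₗ[ℂ] H)
    (Δ : H →ₗ[ℂ] H) : ∃ br : H →ₗ[ℂ] H →ₗ[ℂ] H,
      ∀ (p : ℤ) (u v : H), u ∈ gr p → br u v = (-1 : ℂ) ^ p • bvDefect mul Δ p u v := by
  -- `σ` makes the sign `(-1)^p` linear in `u`; in the last term of the bracket the two signs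
  -- cancel.
  obtain ⟨σ, hσ⟩ := exists_diagonal hind htop fun p : ℤ => (-1 : ℂ) ^ p
  refine ⟨(mul ∘ₗ σ).compr₂ Δ - mul ∘ₗ Δ ∘ₗ σ - mul.compl₂ Δ, fun p u v hu => ?_⟩
  simp only [bvDefect, LinearMap.sub_apply, LinearMap.compr₂_apply, LinearMap.comp_apply,
    LinearMap.compl₂_apply, hσ p u hu, map_smul, LinearMap.smul_apply, neg_one_zpow_eq_ite]
  by_cases hp : Even p <;> simp [hp] <;> module

lemma IsSupercommutative.exists_commRing {H : Type u} [AddCommGroup H] [Module ℂ H]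
    {gr : ℤ → Submodule ℂ H} {mul : H →ₗ[ℂ] H →ₗ[ℂ] H} {e : H}
    (hm : IsSupercommutative gr mul e) :
    ∃ (R : Type u) (_ : CommRing R) (_ : Algebra ℂ R) (φ : R ≃ₗ[ℂ] gr 0),
      (φ 1 : H) = e ∧ ∀ x y : R, (φ (x * y) : H) = mul (φ x) (φ y) := by
  let i : CommRing (gr 0) :=
    { (inferInstance : AddCommGroup (gr 0)) with
      mul := fun x y => ⟨mul x y, hm.mul_mem 0 0 x y x.2 y.2⟩
      one := ⟨e, hm.unit_mem⟩
      mul_assoc := fun x y z => Subtype.ext (hm.assoc x y z)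
      one_mul := fun x => Subtype.ext (hm.unit_mul x)
      mul_one := fun x => Subtype.ext (hm.mul_unit x)
      mul_comm := fun x y => Subtype.ext ((hm.comm 0 0 x y x.2 y.2).trans (by simp; rfl))
      left_distrib := fun x y z => Subtype.ext (map_add (mul (x : H)) (y : H) z)
      right_distrib := fun x y z => Subtype.ext (LinearMap.map_add₂ mul x y z)
      zero_mul := fun x => Subtype.ext (LinearMap.map_zero₂ mul x)
      mul_zero := fun x => Subtype.ext (map_zero (mul (x : H))) }
  let a : Algebra ℂ (gr 0) := Algebra.ofModule
    (fun c x y => Subtype.ext (LinearMap.map_smul₂ mul c x y))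
    (fun c x y => Subtype.ext (map_smul (mul (x : H)) c (y : H)))
  exact ⟨gr 0, i, a, LinearEquiv.refl ℂ _, rfl, fun x y => rfl⟩

/-- The shifted degree `p - 1` is zero here, so every Gerstenhaber sign is trivial. -/
lemma IsGerstenhaberBracket.exists_lieAlgebra {H : Type u} [AddCommGroup H] [Module ℂ H]
    {gr : ℤ → Submodule ℂ H} {mul br : H →ₗ[ℂ] H →ₗ[ℂ] H}
    (hb : IsGerstenhaberBracket gr mul br) :
    ∃ (𝔤 : Type u) (_ : LieRing 𝔤) (_ : LieAlgebra ℂ 𝔤) (ψ : 𝔤 ≃ₗ[ℂ] gr 1),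
      ∀ x y : 𝔤, (ψ ⁅x, y⁆ : H) = br (ψ x) (ψ y) := by
  have skew : ∀ x y : H, x ∈ gr 1 → y ∈ gr 1 → br x y = -br y x := fun x y hx hy => by
    simpa using hb.skew 1 1 x y hx hy
  have mem : ∀ x y : H, x ∈ gr 1 → y ∈ gr 1 → br x y ∈ gr 1 := fun x y hx hy => by
    simpa using hb.degree 1 1 x y hx hy
  -- Skew symmetry gives only `br x x = -br x x`; the absence of 2-torsion makes this zero.
  have : IsAddTorsionFree H := .of_isTorsionFree ℂ H
  let i : LieRing (gr 1) :=
    { (inferInstance : AddCommGroup (gr 1)) with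
      bracket := fun x y => ⟨br x y, mem x y x.2 y.2⟩
      add_lie := fun x y z => Subtype.ext (LinearMap.map_add₂ br x y z)
      lie_add := fun x y z => Subtype.ext (map_add (br (x : H)) (y : H) z)
      lie_self := fun x => Subtype.ext (self_eq_neg.1 (skew x x x.2 x.2))
      leibniz_lie := fun x y z => Subtype.ext (by
        change br (x : H) (br y z) = br (br (x : H) y) z + br (y : H) (br x z)
        have h := hb.jacobi 1 1 1 x y z x.2 y.2 z.2
        rw [skew z (br (x : H) y) z.2 (mem x y x.2 y.2), skew z x z.2 x.2] at h
        simp only [sub_self, mul_zero, zpow_zero, one_smul, map_neg] at h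
        rw [← sub_eq_zero, ← h]
        abel) }
  let a : LieAlgebra ℂ (gr 1) :=
    { (inferInstance : Module ℂ (gr 1)) with
      lie_smul := fun c x y => Subtype.ext (map_smul (br (x : H)) c (y : H)) }
  exact ⟨gr 1, i, a, LinearEquiv.refl ℂ _, fun x y => rfl⟩

end BVAlgebra

/-! ### Koszul signs and finite sums -/

lemma koszulSign_intCast (p q : ℤ) : koszulSign (p : ZMod 2) (q : ZMod 2) = (-1) ^ (p * q) := by
  have cast : ∀ n : ℤ, (n : ZMod 2) = if Even n then 0 else 1 := fun n => by
    split_ifs with h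
    · exact (ZMod.intCast_eq_zero_iff_even).2 h
    · exact (ZMod.intCast_eq_one_iff_odd).2 (Int.not_even_iff_odd.1 h)
  rw [koszulSign, cast, cast, neg_one_zpow_eq_ite]
  by_cases hp : Even p <;> by_cases hq : Even q <;> simp [hp, hq, Int.even_mul, ZMod.val_one]

lemma finsum_eq_add_of_two_le {M : Type*} [AddCommGroup M] {f : ℕ → M}
    (h : ∀ r, 2 ≤ r → f r = 0) : ∑ᶠ r, f r = f 0 + f 1 := by
  rw [finsum_eq_sum_of_support_subset (s := Finset.range 2), Finset.sum_range_succ,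
    Finset.sum_range_one]
  intro r hr
  by_contra h'
  exact hr (h r (by simp at h'; omega))

/-- Isolates the `r = 0` term of a Borcherds sum modulo exact vectors. The bound `N` matters: a
`finsum` of infinite support is zero by convention. -/
lemma finsum_sub_apply_zero_mem {M : Type*} [AddCommGroup M] [Module ℂ M] {S : Submodule ℂ M}
    {f : ℕ → M} {N : ℕ} (hN : ∀ r, N ≤ r → f r = 0) (hf : ∀ r, r ≠ 0 → f r ∈ S) :
    ∑ᶠ r, f r - f 0 ∈ S := by
  rw [finsum_eq_sum_of_support_subset (s := Finset.range (N + 1)), Finset.sum_range_succ',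
    add_sub_cancel_right]
  · exact sum_mem fun r _ => hf _ r.succ_ne_zero
  · intro r hr
    by_contra h'
    exact hr (hN r (by simp at h'; omega))

/-! ### Special cases of the Borcherds identity -/

namespace VertexSuperalgebra

variable {V : Type*} [AddCommGroup V] [Module ℂ V] (A : VertexSuperalgebra V)

/-- The mode `a₍ₙ₎` as a linear function of the state `a`. -/
noncomputable def modeLin (n : ℤ) : V →ₗ[ℂ] V →ₗ[ℂ] V :=
  LinearMap.proj n ∘ₗ VertexOperator.ncoeff ∘ₗ A.Y

@[simp] lemma modeLin_apply (n : ℤ) (a : V) : A.modeLin n a = A.mode a n := rfl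

lemma mode_smul (c : ℂ) (a : V) (n : ℤ) : A.mode (c • a) n = c • A.mode a n :=
  map_smul (A.modeLin n) c a

lemma mode_zero (n : ℤ) : A.mode 0 n = 0 := map_zero (A.modeLin n)

lemma mode_vac (n : ℤ) (b : V) : A.mode A.vac n b = if n = -1 then b else 0 := A.vac_mode n b

lemma mode_apply_vac {n : ℤ} (hn : 0 ≤ n) (a : V) : A.mode a n A.vac = 0 :=
  A.mode_vac_nonneg a n hn

lemma mode_neg_one_vac (a : V) : A.mode a (-1) A.vac = a := A.mode_vac_neg_one a

lemma exists_mode_eq_zero (a b : V) : ∃ N : ℤ, ∀ n, N ≤ n → A.mode a n b = 0 :=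
  ⟨-((HahnModule.of ℂ).symm (A.Y a b)).order, fun n hn =>
    VertexOperator.ncoeff_eq_zero_of_lt_order _ _ _ (by omega)⟩

lemma iSup_parity : iSup A.parity = ⊤ := A.parity_isInternal.submodule_iSup_eq_top

/-- The commutator formula, the case `n = 0` of the Borcherds identity. -/
lemma finsum_mode_mode {i j : ZMod 2} {a b : V} (ha : a ∈ A.parity i) (hb : b ∈ A.parity j)
    (c : V) (m k : ℤ) :
    ∑ᶠ r : ℕ, (Ring.choose m r : ℤ) • A.mode (A.mode a r b) (m + k - r) c =
      A.mode a m (A.mode b k c) - koszulSign i j • A.mode b k (A.mode a m c) := by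
  have h := A.borcherds i j a b c m 0 k ha hb
  rw [finsum_eq_single (α := ℕ) (f := fun r => ((-1) ^ r * Ring.choose 0 r : ℤ) • _) (a := 0)] at h
  · simpa [mode] using h
  · intro r hr
    rw [Ring.choose_zero_pos _ (Nat.pos_of_ne_zero hr)]
    simp

/-- The binomials `choose 0 r` vanish for `r > 0`, so a zero mode is a superderivation of all
products. This is used for `Q`, for `F₀` and for the bracket. -/
lemma mode_zero_mode {i j : ZMod 2} {a b : V} (ha : a ∈ A.parity i) (hb : b ∈ A.parity j)
    (c : V) (k : ℤ) :
    A.mode a 0 (A.mode b k c) =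
      A.mode (A.mode a 0 b) k c + koszulSign i j • A.mode b k (A.mode a 0 c) := by
  rw [← sub_eq_iff_eq_add, ← A.finsum_mode_mode ha hb, finsum_eq_single _ 0]
  · simp
  · intro r hr
    rw [Ring.choose_zero_pos _ (Nat.pos_of_ne_zero hr), zero_smul]

/-- Only `r = 0, 1` contribute. For `a = G` the extra term is the BV defect; for `a = L` it gives
additivity of weights. -/
lemma mode_one_mode {i j : ZMod 2} {a b : V} (ha : a ∈ A.parity i) (hb : b ∈ A.parity j)
    (c : V) (k : ℤ) :
    A.mode a 1 (A.mode b k c) = A.mode (A.mode a 0 b) (k + 1) c + A.mode (A.mode a 1 b) k c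
      + koszulSign i j • A.mode b k (A.mode a 1 c) := by
  rw [← sub_eq_iff_eq_add, ← A.finsum_mode_mode ha hb, finsum_eq_add_of_two_le]
  · simp [add_comm]
  · intro r hr
    have : Ring.choose (1 : ℤ) r = 0 := by
      rw [← Nat.cast_one, Ring.choose_natCast, Nat.choose_eq_zero_of_lt hr, Nat.cast_zero]
    rw [this, zero_smul]

lemma choose_neg_one (r : ℕ) : Ring.choose (-1 : ℤ) r = (-1) ^ r := by
  rw [Ring.choose_neg', Ring.multichoose_one]
  simp [Int.negOnePow, Units.smul_def]

lemma choose_neg_two (r : ℕ) : (-1) ^ r * Ring.choose (-2 : ℤ) r = r + 1 := by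
  have h : ((-1) ^ r * (-1) ^ r : ℤ) = 1 := by rw [← mul_pow]; simp
  rw [Ring.choose_neg', Ring.multichoose_two]
  simp only [Int.negOnePow, Units.smul_def, zpow_natCast, Units.val_pow_eq_pow_val, Units.val_neg,
    Units.val_one, smul_eq_mul]
  linear_combination (r + 1 : ℤ) * h

/-- Associativity of the Wick product up to further terms, the case `m = 0`, `n = k = -1` of the
Borcherds identity. -/
lemma wick_wick {i j : ZMod 2} {a b : V} (ha : a ∈ A.parity i) (hb : b ∈ A.parity j) (c : V) :
    A.wick (A.wick a b) c = ∑ᶠ r : ℕ, (A.mode a (-1 - r) (A.mode b (-1 + r) c)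
      + koszulSign i j • A.mode b (-2 - r) (A.mode a r c)) := by
  have h := A.borcherds i j a b c 0 (-1) (-1) ha hb
  rw [finsum_eq_single _ 0] at h
  · simp only [Ring.choose_zero_right, choose_neg_one, ← mul_pow] at h
    simpa [mode, wick] using h
  · intro r hr
    rw [Ring.choose_zero_pos _ (Nat.pos_of_ne_zero hr), zero_smul]

lemma mode_translation (a c : V) (k : ℤ) :
    A.mode (A.translation a) k c = -(k : ℂ) • A.mode a (k - 1) c := by
  have key : A.modeLin k ∘ₗ (A.modeLin (-2)).flip A.vac = -(k : ℂ) • A.modeLin (k - 1) := by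
    refine linearMap_ext_of_iSup A.iSup_parity fun i a ha => LinearMap.ext fun c => ?_
    have h := A.borcherds i 0 a A.vac c 0 (-2) k ha A.vac_even
    rw [finsum_eq_single _ 0] at h
    swap
    · intro r hr
      rw [Ring.choose_zero_pos _ (Nat.pos_of_ne_zero hr), zero_smul]
    simp only [choose_neg_two, A.vac_mode, Ring.choose_zero_right, koszulSign, ZMod.val_zero,
      mul_zero, pow_zero, one_mul, Nat.cast_zero, add_zero, sub_zero, zero_add, one_smul] at h
    simp only [LinearMap.comp_apply, LinearMap.flip_apply, modeLin_apply, LinearMap.smul_apply]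
    refine h.trans ?_
    -- The vacuum modes select one summand: `r = -1 - k` in the first half if `k < 0`, `r = k - 1`
    -- in the second if `k > 0`, none if `k = 0`.
    rcases lt_trichotomy k 0 with hk | rfl | hk
    · obtain ⟨s, rfl⟩ : ∃ s : ℕ, k = -1 - s := ⟨(-1 - k).toNat, by omega⟩
      rw [finsum_eq_single _ s]
      · rw [if_pos (by ring), if_neg (by omega)]
        simp only [mode, ← Int.cast_smul_eq_zsmul ℂ]
        rw [show (-2 - s : ℤ) = -1 - s - 1 by ring]
        push_cast
        rw [smul_zero, sub_zero]
        congr 1; ring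
      · intro r hr
        rw [if_neg (by omega), if_neg (by omega)]
        simp
    · rw [finsum_eq_zero_of_forall_eq_zero]
      · simp
      · intro r
        rw [if_neg (by omega), if_neg (by omega)]
        simp
    · obtain ⟨s, rfl⟩ : ∃ s : ℕ, k = s + 1 := ⟨(k - 1).toNat, by omega⟩
      rw [finsum_eq_single _ s]
      · rw [if_neg (by omega), if_pos (by ring)]
        simp only [mode, ← Int.cast_smul_eq_zsmul ℂ]
        rw [show (s + 1 - 1 : ℤ) = s by ring, show ((-1 : ℂ) ^ (-2 : ℤ)) = 1 by norm_num]
        push_cast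
        rw [map_zero, zero_sub, one_smul, smul_neg, neg_smul]
      · intro r hr
        rw [if_neg (by omega), if_neg (by omega)]
        simp
  exact LinearMap.congr_fun (LinearMap.congr_fun key a) c

/-- Evenness of `x` removes the Koszul sign, so the formula is linear in `a` and extends from
homogeneous vectors. -/
lemma mode_zero_mode_of_even {x : V} (hx : x ∈ A.parity 0) (a c : V) (k : ℤ) :
    A.mode x 0 (A.mode a k c) = A.mode (A.mode x 0 a) k c + A.mode a k (A.mode x 0 c) := by
  have key : (A.modeLin k).compr₂ (A.mode x 0) =
      A.modeLin k ∘ₗ A.mode x 0 + (A.modeLin k).compl₂ (A.mode x 0) :=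
    linearMap_ext_of_iSup A.iSup_parity fun i a ha => LinearMap.ext fun c => by
      simpa [koszulSign] using A.mode_zero_mode hx ha c k
  exact LinearMap.congr_fun (LinearMap.congr_fun key a) c

lemma mode_one_mode_of_even {x : V} (hx : x ∈ A.parity 0) (a c : V) (k : ℤ) :
    A.mode x 1 (A.mode a k c) = A.mode (A.mode x 0 a) (k + 1) c + A.mode (A.mode x 1 a) k c
      + A.mode a k (A.mode x 1 c) := by
  have key : (A.modeLin k).compr₂ (A.mode x 1) = A.modeLin (k + 1) ∘ₗ A.mode x 0 +
      A.modeLin k ∘ₗ A.mode x 1 + (A.modeLin k).compl₂ (A.mode x 1) :=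
    linearMap_ext_of_iSup A.iSup_parity fun i a ha => LinearMap.ext fun c => by
      simpa [koszulSign] using A.mode_one_mode hx ha c k
  exact LinearMap.congr_fun (LinearMap.congr_fun key a) c

end VertexSuperalgebra

/-! ### Fermion number and the differential -/

namespace TopologicalVOA

open VertexSuperalgebra

variable {V : Type*} [AddCommGroup V] [Module ℂ V] (C : TopologicalVOA V)

lemma Q_apply (v : V) : C.Q v = C.mode C.J 0 v := rfl

lemma G₀_apply (v : V) : C.G₀ v = C.mode C.G 1 v := rfl

lemma L₀_apply (v : V) : C.L₀ v = C.mode C.L 1 v := rfl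

lemma mem_fermion {p : ℤ} {u : V} : u ∈ C.fermion p ↔ C.mode C.F 0 u = (p : ℂ) • u :=
  Module.End.mem_eigenspace_iff

lemma mem_parity_of_mem_fermion {p : ℤ} {u : V} (hu : u ∈ C.fermion p) :
    u ∈ C.parity (p : ZMod 2) := C.fermion_parity p hu

lemma iSup_fermion : iSup C.fermion = ⊤ := C.fermion_span

lemma iSupIndep_fermion : iSupIndep C.fermion :=
  (Module.End.eigenspaces_iSupIndep (C.mode C.F 0)).comp Int.cast_injective

lemma mode_mem_fermion {p q : ℤ} {a b : V} (ha : a ∈ C.fermion p) (hb : b ∈ C.fermion q)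
    (n : ℤ) : C.mode a n b ∈ C.fermion (p + q) := by
  rw [mem_fermion] at *
  rw [C.mode_zero_mode_of_even C.F_even, ha, hb, mode_smul, map_smul, Int.cast_add, add_smul,
    LinearMap.smul_apply]

lemma J_mem_fermion : C.J ∈ C.fermion 1 := by
  rw [mem_fermion, C.J_fermion]; simp

lemma G_mem_fermion : C.G ∈ C.fermion (-1) := by
  rw [mem_fermion, C.G_fermion]; simp

lemma vac_mem_fermion : C.vac ∈ C.fermion 0 := by
  rw [mem_fermion, C.mode_apply_vac le_rfl]; simp

lemma Q_mem_fermion {p : ℤ} {u : V} (hu : u ∈ C.fermion p) : C.Q u ∈ C.fermion (p + 1) :=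
  add_comm 1 p ▸ C.mode_mem_fermion C.J_mem_fermion hu 0

lemma G₀_mem_fermion {p : ℤ} {u : V} (hu : u ∈ C.fermion p) : C.G₀ u ∈ C.fermion (p - 1) := by
  rw [sub_eq_neg_add]
  exact C.mode_mem_fermion C.G_mem_fermion hu 1

lemma Q_Q (v : V) : C.Q (C.Q v) = 0 := C.Q_sq v

lemma Q_vac : C.Q C.vac = 0 := C.mode_apply_vac le_rfl C.J

lemma L₀_eq (v : V) : C.L₀ v = C.Q (C.G₀ v) + C.G₀ (C.Q v) := (C.Q_G 1 v).symm

lemma translation_eq (v : V) :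
    C.translation v = C.Q (C.mode C.G 0 v) + C.mode C.G 0 (C.Q v) := by
  rw [← C.L_neg_one]; exact (C.Q_G 0 v).symm

lemma Q_mode_of_mem_fermion {p : ℤ} {a : V} (ha : a ∈ C.fermion p) (k : ℤ) (c : V) :
    C.Q (C.mode a k c) = C.mode (C.Q a) k c + (-1 : ℂ) ^ p • C.mode a k (C.Q c) := by
  have h := C.mode_zero_mode C.J_odd (C.mem_parity_of_mem_fermion ha) c k
  rw [show (1 : ZMod 2) = ((1 : ℤ) : ZMod 2) by simp, koszulSign_intCast, one_mul] at h
  exact h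

/-- `Q` is a superderivation of all products, where `σ` is the parity involution. -/
lemma exists_Q_mode : ∃ σ : V →ₗ[ℂ] V, (∀ a, σ (σ a) = a) ∧ (∀ a, C.Q a = 0 → C.Q (σ a) = 0) ∧
    ∀ a k c, C.Q (C.mode a k c) = C.mode (C.Q a) k c + C.mode (σ a) k (C.Q c) := by
  obtain ⟨σ, hσ⟩ := exists_diagonal C.iSupIndep_fermion C.iSup_fermion fun p : ℤ => (-1 : ℂ) ^ p
  refine ⟨σ, fun a => ?_, fun a ha => ?_, fun a k c => ?_⟩
  · have key : σ ∘ₗ σ = LinearMap.id := linearMap_ext_of_iSup C.iSup_fermion fun p a ha => by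
      simp only [LinearMap.comp_apply, hσ p a ha, map_smul, smul_smul, LinearMap.id_apply,
        neg_one_zpow_eq_ite]
      split_ifs <;> simp
    exact LinearMap.congr_fun key a
  · have key : C.Q ∘ₗ σ = -(σ ∘ₗ C.Q) := linearMap_ext_of_iSup C.iSup_fermion fun p a ha => by
      simp only [LinearMap.comp_apply, LinearMap.neg_apply, hσ p a ha, map_smul,
        hσ _ _ (C.Q_mem_fermion ha), neg_one_zpow_eq_ite, Int.even_add, Int.not_even_one]
      by_cases hp : Even p <;> simp [hp]
    simpa [ha] using LinearMap.congr_fun key a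
  · have key : (C.modeLin k).compr₂ C.Q =
        C.modeLin k ∘ₗ C.Q + (C.modeLin k ∘ₗ σ).compl₂ C.Q :=
      linearMap_ext_of_iSup C.iSup_fermion fun p a ha => LinearMap.ext fun c => by
        simpa [hσ p a ha, mode_smul] using C.Q_mode_of_mem_fermion ha k c
    exact LinearMap.congr_fun (LinearMap.congr_fun key a) c

/-! ### Products of closed vectors modulo exact ones -/

variable {C}

lemma Q_mode_eq_zero {a c : V} (ha : C.Q a = 0) (hc : C.Q c = 0) (k : ℤ) :
    C.Q (C.mode a k c) = 0 := by
  obtain ⟨σ, -, -, h⟩ := C.exists_Q_mode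
  rw [h, ha, hc, mode_zero, map_zero, LinearMap.zero_apply, add_zero]

lemma mode_Q_left_mem_range (a : V) {c : V} (hc : C.Q c = 0) (k : ℤ) :
    C.mode (C.Q a) k c ∈ LinearMap.range C.Q := by
  obtain ⟨σ, -, -, h⟩ := C.exists_Q_mode
  exact ⟨C.mode a k c, by rw [h, hc, map_zero, add_zero]⟩

lemma mode_Q_right_mem_range {a : V} (ha : C.Q a = 0) (c : V) (k : ℤ) :
    C.mode a k (C.Q c) ∈ LinearMap.range C.Q := by
  obtain ⟨σ, h1, h2, h⟩ := C.exists_Q_mode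
  exact ⟨C.mode (σ a) k c, by rw [h, h1, h2 a ha, mode_zero, LinearMap.zero_apply, zero_add]⟩

/-- The modes `a₍ₙ₎`, `n ≠ -1`, of a closed vector act by zero on the cohomology. -/
lemma mode_mem_range {a c : V} (ha : C.Q a = 0) (hc : C.Q c = 0) {n : ℤ} (hn : n ≠ -1) :
    C.mode a n c ∈ LinearMap.range C.Q := by
  -- For closed `a`, `∂a = Q(G₍₀₎a)`, and `(∂a)₍ₙ₊₁₎ = -(n+1) a₍ₙ₎`; division by `n + 1` excludes `n
  -- = -1`.
  have h := C.mode_translation a c (n + 1)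
  rw [translation_eq, ha, map_zero, add_zero, add_sub_cancel_right] at h
  have hn' : (-((n + 1 : ℤ) : ℂ)) ≠ 0 := by
    rw [neg_ne_zero, Int.cast_ne_zero]; omega
  rw [← (Submodule.smul_mem_iff _ hn'), ← h]
  exact mode_Q_left_mem_range _ hc _

/-- The commutator of `a₍₋₁₎` and `b₍₋₁₎` on the vacuum is a sum of `(a₍ᵣ₎b)₍₋₂₋ᵣ₎1` with `r ≥ 0`;
no index is `-1`, so each term is exact. -/
lemma wick_comm_mem_range {p q : ℤ} {a b : V} (hpa : a ∈ C.fermion p) (hqb : b ∈ C.fermion q)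
    (ha : C.Q a = 0) (hb : C.Q b = 0) :
    C.wick a b - (-1 : ℂ) ^ (p * q) • C.wick b a ∈ LinearMap.range C.Q := by
  have h := C.finsum_mode_mode (C.mem_parity_of_mem_fermion hpa) (C.mem_parity_of_mem_fermion hqb)
    C.vac (-1) (-1)
  rw [mode_neg_one_vac, mode_neg_one_vac, koszulSign_intCast] at h
  rw [wick, wick, ← h]
  refine finsum_induction (· ∈ LinearMap.range C.Q) (zero_mem _) (fun _ _ => add_mem) fun r => ?_
  exact zsmul_mem (mode_mem_range (Q_mode_eq_zero ha hb _) C.Q_vac (by omega)) _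

/-- In `wick_wick` every term except `a₍₋₁₎b₍₋₁₎c` has an outer mode of index other than `-1`. -/
lemma wick_assoc_mem_range {p q : ℤ} {a b c : V} (hpa : a ∈ C.fermion p) (hqb : b ∈ C.fermion q)
    (ha : C.Q a = 0) (hb : C.Q b = 0) (hc : C.Q c = 0) :
    C.wick (C.wick a b) c - C.wick a (C.wick b c) ∈ LinearMap.range C.Q := by
  obtain ⟨M, hM⟩ := C.exists_mode_eq_zero b c
  obtain ⟨N, hN⟩ := C.exists_mode_eq_zero a c
  have h := finsum_sub_apply_zero_mem (S := LinearMap.range C.Q)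
    (f := fun r : ℕ => C.mode a (-1 - r) (C.mode b (-1 + r) c)
      + koszulSign (p : ZMod 2) (q : ZMod 2) • C.mode b (-2 - r) (C.mode a r c))
    (N := (max (M + 1) N).toNat) (fun r hr => by
      rw [hM _ (by omega), hN _ (by omega)]; simp)
    (fun r hr => add_mem (mode_mem_range ha (Q_mode_eq_zero hb hc _) (by omega))
      (Submodule.smul_mem _ _ (mode_mem_range hb (Q_mode_eq_zero ha hc _) (by omega))))
  rw [← C.wick_wick (C.mem_parity_of_mem_fermion hpa) (C.mem_parity_of_mem_fermion hqb),
    ← sub_sub] at h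
  -- The other half of the `r = 0` term, `b₍₋₂₎a₍₀₎c`, is exact as well.
  have h' := add_mem h (Submodule.smul_mem _ (koszulSign (p : ZMod 2) (q : ZMod 2))
    (mode_mem_range hb (Q_mode_eq_zero ha hc 0) (show (-2 : ℤ) ≠ -1 by omega)))
  simpa [wick] using h'

/-! ### Conformal weight, `G₀` and its square -/

variable (C)

lemma L₀_mode (a c : V) (k : ℤ) : C.L₀ (C.mode a k c) =
    -((k + 1 : ℤ) : ℂ) • C.mode a k c + C.mode (C.L₀ a) k c + C.mode a k (C.L₀ c) := by
  rw [L₀_apply, C.mode_one_mode_of_even C.L_even, C.L_neg_one, mode_translation,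
    add_sub_cancel_right]
  rfl

lemma L₀_Q (v : V) : C.L₀ (C.Q v) = C.Q (C.L₀ v) := by
  rw [L₀_eq, L₀_eq, Q_Q, map_zero, add_zero, map_add, Q_Q, zero_add]

lemma L₀_G : C.L₀ C.G = (2 : ℂ) • C.G := C.G_primary.1

/-- The mode `G₍₁₎` shifts weight by `-2`, which the weight `2` of `G` compensates. -/
lemma L₀_G₀ (v : V) : C.L₀ (C.G₀ v) = C.G₀ (C.L₀ v) := by
  simp only [G₀_apply]
  rw [L₀_mode, L₀_G, mode_smul]
  simp only [LinearMap.smul_apply]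
  push_cast
  module

lemma L₀_F (v : V) : C.L₀ (C.mode C.F 0 v) = C.mode C.F 0 (C.L₀ v) := by
  rw [L₀_mode, show C.L₀ C.F = (1 : ℂ) • C.F from C.F_weight, mode_smul]
  simp

/-- The projection `P` onto the weight zero space and the inverse `R` of `L₀` on its complement. -/
lemma exists_weightZero_projection : ∃ P R : V →ₗ[ℂ] V,
    (∀ v, C.L₀ v = 0 → P v = v) ∧ (∀ v, C.L₀ (P v) = 0) ∧ (∀ v, v - P v = C.L₀ (R v)) ∧
    (∀ f : V →ₗ[ℂ] V, (∀ v, C.L₀ (f v) = f (C.L₀ v)) → ∀ v, P (f v) = f (P v)) ∧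
    (∀ f : V →ₗ[ℂ] V, (∀ v, C.L₀ (f v) = f (C.L₀ v)) → ∀ v, R (f v) = f (R v)) := by
  have htop : ⨆ d : ℂ, Module.End.eigenspace C.L₀ d = ⊤ := C.L_zero_diagonalizable
  have hind := Module.End.eigenspaces_iSupIndep C.L₀
  obtain ⟨P, hP⟩ := exists_diagonal hind htop fun d => if d = 0 then 1 else 0
  -- With `0⁻¹ = 0`, `R` vanishes on weight zero.
  obtain ⟨R, hR⟩ := exists_diagonal hind htop fun d => d⁻¹
  refine ⟨P, R, fun v hv => ?_, fun v => ?_, fun v => ?_,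
    fun f hf => commute_of_eigenspaces htop hP hf, fun f hf => commute_of_eigenspaces htop hR hf⟩
  · simpa using hP 0 v (by simpa [Module.End.mem_eigenspace_iff] using hv)
  · have key : C.L₀ ∘ₗ P = 0 := linearMap_ext_of_iSup htop fun d v hv => by
      rw [LinearMap.comp_apply, hP d v hv, map_smul, Module.End.mem_eigenspace_iff.1 hv]
      split_ifs with h <;> simp [h]
    exact LinearMap.congr_fun key v
  · have key : LinearMap.id - P = C.L₀ ∘ₗ R := linearMap_ext_of_iSup htop fun d v hv => by
      rw [LinearMap.comp_apply, LinearMap.sub_apply, hP d v hv, hR d v hv, map_smul,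
        Module.End.mem_eigenspace_iff.1 hv]
      by_cases h : d = 0 <;> simp [h]
    exact LinearMap.congr_fun key v

/-- The first term on the right is the defect: the `k = -1` case of `mode_one_mode` produces the
mode of index `k + 1 = 0`. -/
lemma G₀_wick {p : ℤ} {u : V} (hu : u ∈ C.fermion p) (v : V) :
    C.G₀ (C.wick u v) = C.mode (C.mode C.G 0 u) 0 v + C.wick (C.G₀ u) v
      + (-1 : ℂ) ^ p • C.wick u (C.G₀ v) := by
  have h := C.mode_one_mode C.G_odd (C.mem_parity_of_mem_fermion hu) v (-1)
  rw [show (1 : ZMod 2) = ((1 : ℤ) : ZMod 2) by simp, koszulSign_intCast, one_mul] at h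
  exact h

lemma Q_G_eq : C.Q C.G = C.L := by
  simpa [mode_neg_one_vac, ← Q_apply, Q_vac] using C.Q_G (-1) C.vac

lemma L_mode_G_eq_zero {n : ℤ} (hn : 2 ≤ n) : C.mode C.L n C.G = 0 := by
  simpa [VertexOperatorSuperalgebra.virasoro] using C.G_primary.2 (n - 1) (by omega)

/-- Skew symmetry, from the commutator of `L₍₋₁₎` and `G₍ₖ₎` on the vacuum; primarity of `G` leaves
only `L₍₀₎G` and `L₍₁₎G`. -/
lemma finsum_L_mode_G (k : ℤ) (hk : 0 ≤ k) :
    C.mode C.G k C.L = C.mode ((2 : ℂ) • C.G) (-2 + k) C.vac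
      - C.mode (C.mode C.L 0 C.G) (-1 + k) C.vac := by
  have h := C.finsum_mode_mode C.L_even C.G_odd C.vac (-1) k
  rw [finsum_eq_add_of_two_le, mode_apply_vac _ hk, mode_neg_one_vac] at h
  · have h1 : C.mode C.L 1 C.G = (2 : ℂ) • C.G := C.L₀_G
    simp only [choose_neg_one, koszulSign, Nat.cast_zero, Nat.cast_one, pow_zero, pow_one,
      ZMod.val_zero, zero_mul, one_smul, map_zero, zero_sub, neg_smul, h1, sub_zero] at h
    rw [← neg_inj, ← h, show (-1 + k - 1 : ℤ) = -2 + k by ring]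
    abel
  · intro r hr
    rw [L_mode_G_eq_zero _ (by omega), mode_zero, LinearMap.zero_apply, smul_zero]

lemma G_mode_zero_L : C.mode C.G 0 C.L = C.mode C.L 0 C.G := by
  rw [finsum_L_mode_G _ _ le_rfl, add_zero, add_zero, mode_neg_one_vac, C.L_neg_one, mode_smul,
    two_smul, LinearMap.add_apply, translation, add_sub_cancel_right]

lemma G_mode_one_L : C.mode C.G 1 C.L = (2 : ℂ) • C.G := by
  rw [finsum_L_mode_G _ _ zero_le_one]
  norm_num [mode_neg_one_vac, mode_apply_vac]

/-- `[Q, G₍ₙ₎] = L₍ₙ₎` and `QG = L` give `Q(G₍ₙ₎G) = L₍ₙ₎G - G₍ₙ₎L`; the two terms agree for `n =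
0`, and for `n = 1` in the next lemma. -/
lemma Q_G_mode_zero_G : C.Q (C.mode C.G 0 C.G) = 0 := by
  have h := C.Q_G 0 C.G
  rw [← Q_apply, ← Q_apply, Q_G_eq, G_mode_zero_L] at h
  simpa using h

lemma Q_G_mode_one_G : C.Q (C.mode C.G 1 C.G) = 0 := by
  have h := C.Q_G 1 C.G
  rw [← Q_apply, ← Q_apply, Q_G_eq, G_mode_one_L, show C.mode C.L 1 C.G = _ from C.L₀_G] at h
  simpa using h

/-- As `G` is odd, the commutator formula for `G₍₁₎` with itself computes `2 G₀²` as `(G₍₀₎G)₍₂₎ +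
(G₍₁₎G)₍₁₎`, modes of closed vectors. -/
lemma G₀_G₀_mem_range {u : V} (hu : C.Q u = 0) : C.G₀ (C.G₀ u) ∈ LinearMap.range C.Q := by
  have h := C.mode_one_mode C.G_odd C.G_odd u 1
  have h1 : koszulSign 1 1 = -1 := by simp [koszulSign, ZMod.val_one]
  have h2 : (2 : ℂ) • C.G₀ (C.G₀ u) =
      C.mode (C.mode C.G 0 C.G) (1 + 1) u + C.mode (C.mode C.G 1 C.G) 1 u := by
    rw [h1, neg_one_smul, ← sub_eq_add_neg, eq_sub_iff_add_eq] at h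
    rw [two_smul]; exact h
  rw [← Submodule.smul_mem_iff _ (two_ne_zero (α := ℂ)), h2]
  exact add_mem (mode_mem_range C.Q_G_mode_zero_G hu (by omega))
    (mode_mem_range C.Q_G_mode_one_G hu (by omega))

end TopologicalVOA

/-! ### Cohomology classes, the grading and the induced operations -/

namespace TopologicalVOA

open VertexSuperalgebra

variable {V : Type*} [AddCommGroup V] [Module ℂ V] {C : TopologicalVOA V}

lemma cls_eq_iff {u v : V} (hu : C.Q u = 0) (hv : C.Q v = 0) :
    C.cls u hu = C.cls v hv ↔ u - v ∈ LinearMap.range C.Q := by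
  rw [cls, cls, Submodule.Quotient.eq]
  rfl

lemma cls_congr {u v : V} (hu : C.Q u = 0) (h : u = v) : C.cls u hu = C.cls v (h ▸ hu) := by
  subst h; rfl

lemma exists_cls (x : C.Cohomology) : ∃ (u : V) (hu : C.Q u = 0), C.cls u hu = x := by
  obtain ⟨⟨u, hu⟩, rfl⟩ := Submodule.Quotient.mk_surjective _ x
  exact ⟨u, LinearMap.mem_ker.1 hu, rfl⟩

lemma cls_add {u v : V} (hu : C.Q u = 0) (hv : C.Q v = 0) :
    C.cls u hu + C.cls v hv = C.cls (u + v) (by rw [map_add, hu, hv, add_zero]) := rfl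

lemma cls_sub {u v : V} (hu : C.Q u = 0) (hv : C.Q v = 0) :
    C.cls u hu - C.cls v hv = C.cls (u - v) (by rw [map_sub, hu, hv, sub_zero]) := rfl

lemma cls_smul (c : ℂ) {u : V} (hu : C.Q u = 0) :
    c • C.cls u hu = C.cls (c • u) (by rw [map_smul, hu, smul_zero]) := rfl

lemma cls_eq_zero {u : V} (hu : C.Q u = 0) (h : u ∈ LinearMap.range C.Q) : C.cls u hu = 0 := by
  rw [show (0 : C.Cohomology) = C.cls 0 (map_zero _) from rfl, cls_eq_iff, sub_zero]
  exact h

lemma mem_H {p : ℤ} {x : C.Cohomology} :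
    x ∈ C.H p ↔ ∃ (u : V) (hu : C.Q u = 0), u ∈ C.fermion p ∧ C.cls u hu = x := by
  constructor
  · rintro ⟨⟨u, hu⟩, h, rfl⟩
    exact ⟨u, LinearMap.mem_ker.1 hu, h, rfl⟩
  · rintro ⟨u, hu, h, rfl⟩
    exact ⟨⟨u, LinearMap.mem_ker.2 hu⟩, h, rfl⟩

variable (C)

lemma exists_linearMap_cls (T : V →ₗ[ℂ] V) (hker : ∀ u, C.Q u = 0 → C.Q (T u) = 0)
    (hrange : ∀ w, T (C.Q w) ∈ LinearMap.range C.Q) :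
    ∃ S : C.Cohomology →ₗ[ℂ] C.Cohomology,
      ∀ (u : V) (hu : C.Q u = 0), S (C.cls u hu) = C.cls (T u) (hker u hu) := by
  refine ⟨Submodule.mapQ _ _ (T.restrict (p := LinearMap.ker C.Q) (q := LinearMap.ker C.Q) hker) ?_,
    fun u hu => rfl⟩
  rintro ⟨_, hu⟩ ⟨w, rfl⟩
  exact hrange w

lemma exists_bilinearMap_cls (B : V →ₗ[ℂ] V →ₗ[ℂ] V)
    (hker : ∀ u v, C.Q u = 0 → C.Q v = 0 → C.Q (B u v) = 0)
    (hleft : ∀ w v, C.Q v = 0 → B (C.Q w) v ∈ LinearMap.range C.Q)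
    (hright : ∀ u w, C.Q u = 0 → B u (C.Q w) ∈ LinearMap.range C.Q) :
    ∃ S : C.Cohomology →ₗ[ℂ] C.Cohomology →ₗ[ℂ] C.Cohomology,
      ∀ (u v : V) (hu : C.Q u = 0) (hv : C.Q v = 0),
        S (C.cls u hu) (C.cls v hv) = C.cls (B u v) (hker u v hu hv) := by
  let N := (LinearMap.range C.Q).submoduleOf (LinearMap.ker C.Q)
  let f : LinearMap.ker C.Q →ₗ[ℂ] LinearMap.ker C.Q →ₗ[ℂ] C.Cohomology :=
    LinearMap.mk₂ ℂ (fun u v => C.cls (B u v) (hker u v u.2 v.2))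
      (fun u u' v => by simp [cls_add]) (fun c u v => by simp [cls_smul])
      (fun u v v' => by simp [cls_add]) (fun c u v => by simp [cls_smul])
  let g : C.Cohomology →ₗ[ℂ] LinearMap.ker C.Q →ₗ[ℂ] C.Cohomology := N.liftQ f (by
    rintro ⟨_, hu⟩ ⟨w, rfl⟩
    exact LinearMap.mem_ker.2 <| LinearMap.ext fun v =>
      cls_eq_zero (hker _ _ hu v.2) (hleft w v v.2))
  refine ⟨(N.liftQ g.flip ?_).flip, fun u v hu hv => rfl⟩
  rintro ⟨_, hv⟩ ⟨w, rfl⟩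
  refine LinearMap.mem_ker.2 (LinearMap.ext fun x => ?_)
  obtain ⟨u, hu, rfl⟩ := exists_cls x
  exact cls_eq_zero (hker _ _ hu hv) (hright u w hu)

/-- `Q` shifts fermion number by one, so the homogeneous components of a closed vector are closed.
-/
lemma iSup_H : iSup C.H = ⊤ := by
  rw [eq_top_iff]
  intro x _
  obtain ⟨u, hu, rfl⟩ := exists_cls x
  obtain ⟨f, hf, hfu⟩ := (Submodule.mem_iSup_iff_exists_finsupp C.fermion u).1
    (C.iSup_fermion ▸ Submodule.mem_top)
  have hproj : ∀ p : ℤ, ∃ T : V →ₗ[ℂ] V, ∀ q, ∀ v ∈ C.fermion q,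
      T v = (if q = p then (1 : ℂ) else 0) • v := fun p =>
    exists_diagonal C.iSupIndep_fermion C.iSup_fermion fun q => if q = p then 1 else 0
  choose T hT using hproj
  have hQT : ∀ p v, T (p + 1) (C.Q v) = C.Q (T p v) := fun p v => by
    have key : T (p + 1) ∘ₗ C.Q = C.Q ∘ₗ T p :=
      linearMap_ext_of_iSup C.iSup_fermion fun q v hv => by
        by_cases h : q = p <;> simp [hT p q v hv, hT (p + 1) _ _ (C.Q_mem_fermion hv), h]
    exact LinearMap.congr_fun key v
  have hTu : ∀ p, T p u = f p := fun p => by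
    rw [← hfu, Finsupp.sum, map_sum, Finset.sum_congr rfl fun q _ => hT p q _ (hf q)]
    simp +contextual
  have hQf : ∀ p, C.Q (f p) = 0 := fun p => by rw [← hTu, ← hQT, hu, map_zero]
  have hmk : C.cls u hu = ∑ p ∈ f.support, C.cls (f p) (hQf p) := by
    have : (⟨u, LinearMap.mem_ker.2 hu⟩ : LinearMap.ker C.Q) =
        ∑ p ∈ f.support, ⟨f p, LinearMap.mem_ker.2 (hQf p)⟩ := by
      ext; simp [← hfu, Finsupp.sum]
    exact (congrArg (Submodule.mkQ _) this).trans (map_sum _ _ _)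
  rw [hmk]
  exact sum_mem fun p _ => Submodule.mem_iSup_of_mem p (mem_H.2 ⟨_, hQf p, hf p, rfl⟩)

lemma F_Q (v : V) : C.mode C.F 0 (C.Q v) = C.Q v + C.Q (C.mode C.F 0 v) := by
  rw [Q_apply, C.mode_zero_mode_of_even C.F_even, C.J_fermion]; rfl

/-- `[F₀, Q] = Q` lets `F₀` descend to cohomology, where `H^p` lies in its eigenspace for `p`. -/
lemma iSupIndep_H : iSupIndep C.H := by
  obtain ⟨S, hS⟩ := C.exists_linearMap_cls (C.mode C.F 0)
    (fun u hu => by have h := C.F_Q u; rw [hu, map_zero, zero_add] at h; exact h.symm)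
    (fun w => ⟨w + C.mode C.F 0 w, by rw [F_Q, map_add]⟩)
  refine ((Module.End.eigenspaces_iSupIndep S).comp (Int.cast_injective (α := ℂ))).mono
    fun p x hx => ?_
  obtain ⟨u, hu, hpu, rfl⟩ := mem_H.1 hx
  rw [Function.comp_apply, Module.End.mem_eigenspace_iff, hS, cls_smul]
  exact cls_congr _ (C.mem_fermion.1 hpu)

lemma isInternal_H : DirectSum.IsInternal C.H :=
  (DirectSum.isInternal_submodule_iff_iSupIndep_and_iSup_eq_top _).2 ⟨C.iSupIndep_H, C.iSup_H⟩

variable {C}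

/-- `G₀R` is a contracting homotopy away from weight zero: `L₀Ru = QG₀Ru` when `u` is closed. -/
lemma sub_mem_range_of_weightZero_projection {P R : V →ₗ[ℂ] V} (hPR : ∀ v, v - P v = C.L₀ (R v))
    (hRQ : ∀ v, R (C.Q v) = C.Q (R v)) {u : V} (hu : C.Q u = 0) :
    u - P u ∈ LinearMap.range C.Q :=
  ⟨C.G₀ (R u), by rw [hPR, L₀_eq, ← hRQ, hu, map_zero, map_zero, add_zero]⟩

lemma exists_weightZero_cls_of_mem_H {p : ℤ} {x : C.Cohomology} (hx : x ∈ C.H p) :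
    ∃ (u : V) (hu : C.Q u = 0), u ∈ C.fermion p ∧ C.L₀ u = 0 ∧ C.cls u hu = x := by
  obtain ⟨P, R, -, hP0, hPR, hPc, hRc⟩ := C.exists_weightZero_projection
  obtain ⟨u, hu, hpu, rfl⟩ := mem_H.1 hx
  refine ⟨P u, by rw [← hPc _ C.L₀_Q, hu, map_zero], ?_, hP0 u, ?_⟩
  · rw [mem_fermion, ← hPc _ C.L₀_F, C.mem_fermion.1 hpu, map_smul]
  · exact ((cls_eq_iff _ _).2 (sub_mem_range_of_weightZero_projection hPR (hRc _ C.L₀_Q) hu)).symm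

lemma exists_weightZero_cls (x : C.Cohomology) :
    ∃ (u : V) (hu : C.Q u = 0), C.L₀ u = 0 ∧ C.cls u hu = x := by
  obtain ⟨P, R, -, hP0, hPR, hPc, hRc⟩ := C.exists_weightZero_projection
  obtain ⟨u, hu, rfl⟩ := exists_cls x
  exact ⟨P u, by rw [← hPc _ C.L₀_Q, hu, map_zero], hP0 u,
    ((cls_eq_iff _ _).2 (sub_mem_range_of_weightZero_projection hPR (hRc _ C.L₀_Q) hu)).symm⟩

lemma Q_G₀_eq_zero {u : V} (hu : C.Q u = 0) (h0 : C.L₀ u = 0) : C.Q (C.G₀ u) = 0 := by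
  rw [L₀_eq, hu, map_zero, add_zero] at h0
  exact h0

lemma Q_wick_eq_zero {u v : V} (hu : C.Q u = 0) (hv : C.Q v = 0) : C.Q (C.wick u v) = 0 :=
  Q_mode_eq_zero hu hv _

lemma L₀_wick_eq_zero {u v : V} (hu : C.L₀ u = 0) (hv : C.L₀ v = 0) :
    C.L₀ (C.wick u v) = 0 := by
  rw [wick, L₀_mode, hu, hv]; simp [mode_zero]

variable (C)

lemma exists_wick_cls : ∃ mul : C.Cohomology →ₗ[ℂ] C.Cohomology →ₗ[ℂ] C.Cohomology,
    ∀ (u v : V) (hu : C.Q u = 0) (hv : C.Q v = 0),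
      mul (C.cls u hu) (C.cls v hv) = C.cls (C.wick u v) (Q_wick_eq_zero hu hv) :=
  C.exists_bilinearMap_cls (C.modeLin (-1)) (fun _ _ hu hv => Q_mode_eq_zero hu hv _)
    (fun w _ hv => mode_Q_left_mem_range w hv _) (fun _ w hu => mode_Q_right_mem_range hu w _)

/-- For closed `u`, `QG₀u = L₀u`, so `G₀` itself does not descend; `G₀ ∘ P` does. -/
lemma exists_G₀_cls : ∃ Δ : C.Cohomology →ₗ[ℂ] C.Cohomology,
    ∀ (u : V) (hu : C.Q u = 0) (h0 : C.L₀ u = 0),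
      Δ (C.cls u hu) = C.cls (C.G₀ u) (Q_G₀_eq_zero hu h0) := by
  obtain ⟨P, R, hP, hP0, -, hPc, -⟩ := C.exists_weightZero_projection
  have hPQ := hPc _ C.L₀_Q
  obtain ⟨Δ, hΔ⟩ := C.exists_linearMap_cls (C.G₀ ∘ₗ P)
    (fun u hu => Q_G₀_eq_zero (by rw [← hPQ, hu, map_zero]) (hP0 u))
    -- In weight zero `G₀` anticommutes with `Q`.
    (fun w => ⟨-C.G₀ (P w), by
      have h := C.L₀_eq (P w)
      rw [hP0] at h
      rw [LinearMap.comp_apply, hPQ, map_neg, neg_eq_iff_add_eq_zero, ← h]⟩)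
  refine ⟨Δ, fun u hu h0 => ?_⟩
  rw [hΔ]
  exact cls_congr _ (by rw [LinearMap.comp_apply, hP u h0])

/-! ### The BV structure on cohomology -/

variable {C} {mul : C.Cohomology →ₗ[ℂ] C.Cohomology →ₗ[ℂ] C.Cohomology}
  {Δ : C.Cohomology →ₗ[ℂ] C.Cohomology}

lemma isSupercommutative_wick (hmul : ∀ (u v : V) (hu : C.Q u = 0) (hv : C.Q v = 0),
      mul (C.cls u hu) (C.cls v hv) = C.cls (C.wick u v) (Q_wick_eq_zero hu hv)) :
    IsSupercommutative C.H mul (C.cls C.vac C.Q_vac) where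
  mul_mem p q x y hx hy := by
    obtain ⟨u, hu, hpu, rfl⟩ := mem_H.1 hx
    obtain ⟨v, hv, hqv, rfl⟩ := mem_H.1 hy
    exact mem_H.2 ⟨_, _, C.mode_mem_fermion hpu hqv _, (hmul u v hu hv).symm⟩
  unit_mem := mem_H.2 ⟨_, _, C.vac_mem_fermion, rfl⟩
  unit_mul x := by
    obtain ⟨u, hu, rfl⟩ := exists_cls x
    rw [hmul]
    exact cls_congr _ (by simp [wick, mode_vac])
  mul_unit x := by
    obtain ⟨u, hu, rfl⟩ := exists_cls x
    rw [hmul]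
    exact cls_congr _ (C.mode_neg_one_vac u)
  assoc x y z := by
    obtain ⟨w, hw, rfl⟩ := exists_cls z
    -- The Borcherds identity needs the first two factors homogeneous; bilinearity in them gives the
    -- general case.
    have hxy : (mul.compr₂ (mul.flip (C.cls w hw))) =
        mul.compl₂ (mul.flip (C.cls w hw)) := by
      refine linearMap_ext_of_iSup C.iSup_H fun p x hx => ?_
      refine linearMap_ext_of_iSup C.iSup_H fun q y hy => ?_
      obtain ⟨u, hu, hpu, rfl⟩ := mem_H.1 hx
      obtain ⟨v, hv, hqv, rfl⟩ := mem_H.1 hy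
      simp only [LinearMap.compr₂_apply, LinearMap.compl₂_apply, LinearMap.flip_apply, hmul]
      exact (cls_eq_iff _ _).2 (wick_assoc_mem_range hpu hqv hu hv hw)
    exact LinearMap.congr_fun (LinearMap.congr_fun hxy x) y
  comm p q x y hx hy := by
    obtain ⟨u, hu, hpu, rfl⟩ := mem_H.1 hx
    obtain ⟨v, hv, hqv, rfl⟩ := mem_H.1 hy
    rw [hmul, hmul, cls_smul, cls_eq_iff]
    exact wick_comm_mem_range hpu hqv hu hv

lemma map_mem_H (hΔ : ∀ (u : V) (hu : C.Q u = 0) (h0 : C.L₀ u = 0),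
      Δ (C.cls u hu) = C.cls (C.G₀ u) (Q_G₀_eq_zero hu h0))
    (p : ℤ) (x : C.Cohomology) (hx : x ∈ C.H p) : Δ x ∈ C.H (p - 1) := by
  obtain ⟨u, hu, hpu, h0, rfl⟩ := exists_weightZero_cls_of_mem_H hx
  rw [hΔ u hu h0]
  exact mem_H.2 ⟨_, _, C.G₀_mem_fermion hpu, rfl⟩

lemma map_map_eq_zero (hΔ : ∀ (u : V) (hu : C.Q u = 0) (h0 : C.L₀ u = 0),
      Δ (C.cls u hu) = C.cls (C.G₀ u) (Q_G₀_eq_zero hu h0)) (x : C.Cohomology) :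
    Δ (Δ x) = 0 := by
  obtain ⟨u, hu, h0, rfl⟩ := exists_weightZero_cls x
  rw [hΔ u hu h0, hΔ _ _ (by rw [L₀_G₀, h0, map_zero])]
  exact cls_eq_zero _ (C.G₀_G₀_mem_range hu)

/-- `G₍₀₎u` need not be closed, but `Q(G₍₀₎u) = ∂u` and `(∂u)₍₀₎ = 0`. -/
lemma Q_mode_G_mode_eq_zero {u v : V} (hu : C.Q u = 0) (hv : C.Q v = 0) :
    C.Q (C.mode (C.mode C.G 0 u) 0 v) = 0 := by
  obtain ⟨σ, -, -, h⟩ := C.exists_Q_mode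
  have h1 := C.translation_eq u
  rw [hu, map_zero, add_zero] at h1
  rw [h, ← h1, mode_translation, hv]
  simp

/-- The failure of `G₀` to be a derivation is the zero mode of `G₍₀₎u`. -/
lemma bvDefect_cls (hmul : ∀ (u v : V) (hu : C.Q u = 0) (hv : C.Q v = 0),
      mul (C.cls u hu) (C.cls v hv) = C.cls (C.wick u v) (Q_wick_eq_zero hu hv))
    (hΔ : ∀ (u : V) (hu : C.Q u = 0) (h0 : C.L₀ u = 0),
      Δ (C.cls u hu) = C.cls (C.G₀ u) (Q_G₀_eq_zero hu h0))
    {p : ℤ} {u v : V} (hpu : u ∈ C.fermion p) (hu : C.Q u = 0) (hv : C.Q v = 0)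
    (hu0 : C.L₀ u = 0) (hv0 : C.L₀ v = 0) :
    bvDefect mul Δ p (C.cls u hu) (C.cls v hv) =
      C.cls (C.mode (C.mode C.G 0 u) 0 v) (Q_mode_G_mode_eq_zero hu hv) := by
  rw [bvDefect, hmul, hΔ _ _ (L₀_wick_eq_zero hu0 hv0), hΔ u hu hu0, hΔ v hv hv0, hmul, hmul,
    cls_smul, cls_sub, cls_sub]
  exact cls_congr _ (by rw [C.G₀_wick hpu]; abel)

/-- On representatives of weight zero the defect is a zero mode of fermion number `p - 1`, and the
Leibniz rule already holds for vectors by `mode_zero_mode`. -/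
lemma bvDefect_leibniz (hmul : ∀ (u v : V) (hu : C.Q u = 0) (hv : C.Q v = 0),
      mul (C.cls u hu) (C.cls v hv) = C.cls (C.wick u v) (Q_wick_eq_zero hu hv))
    (hΔ : ∀ (u : V) (hu : C.Q u = 0) (h0 : C.L₀ u = 0),
      Δ (C.cls u hu) = C.cls (C.G₀ u) (Q_G₀_eq_zero hu h0))
    (p q : ℤ) (x y z : C.Cohomology) (hx : x ∈ C.H p) (hy : y ∈ C.H q) :
    bvDefect mul Δ p x (mul y z) =
      mul (bvDefect mul Δ p x y) z + (-1 : ℂ) ^ ((p - 1) * q) • mul y (bvDefect mul Δ p x z) := by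
  obtain ⟨u, hu, hpu, hu0, rfl⟩ := exists_weightZero_cls_of_mem_H hx
  obtain ⟨v, hv, hqv, hv0, rfl⟩ := exists_weightZero_cls_of_mem_H hy
  obtain ⟨w, hw, hw0, rfl⟩ := exists_weightZero_cls z
  rw [hmul, bvDefect_cls hmul hΔ hpu hu _ hu0 (L₀_wick_eq_zero hv0 hw0),
    bvDefect_cls hmul hΔ hpu hu hv hu0 hv0, bvDefect_cls hmul hΔ hpu hu hw hu0 hw0, hmul, hmul,
    cls_smul, cls_add]
  have hG : C.mode C.G 0 u ∈ C.fermion (p - 1) := by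
    rw [sub_eq_neg_add]; exact C.mode_mem_fermion C.G_mem_fermion hpu 0
  have h := C.mode_zero_mode (C.mem_parity_of_mem_fermion hG) (C.mem_parity_of_mem_fermion hqv)
    w (-1)
  rw [koszulSign_intCast] at h
  exact cls_congr _ h

end TopologicalVOA

theorem mainTheorem9 {V : Type u} [AddCommGroup V] [Module ℂ V] (C : TopologicalVOA V) :
    -- the cohomology is graded by the fermion number
    DirectSum.IsInternal C.H ∧
    -- every class has a closed representative of conformal weight zero
    (∀ x : C.Cohomology, ∃ (u : V) (hu : C.Q u = 0), C.L₀ u = 0 ∧ C.cls u hu = x) ∧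
    ∃ (mul br : C.Cohomology →ₗ[ℂ] C.Cohomology →ₗ[ℂ] C.Cohomology)
      (Δ : C.Cohomology →ₗ[ℂ] C.Cohomology) (e : C.Cohomology),
      -- the Wick product, the vacuum and `G₀` descend to `mul`, `e` and `Δ`
      (∀ (u v : V) (hu : C.Q u = 0) (hv : C.Q v = 0), ∃ huv : C.Q (C.wick u v) = 0,
        mul (C.cls u hu) (C.cls v hv) = C.cls (C.wick u v) huv) ∧
      (∃ h : C.Q C.vac = 0, e = C.cls C.vac h) ∧
      (∀ (u : V) (hu : C.Q u = 0), C.L₀ u = 0 →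
        ∃ hGu : C.Q (C.G₀ u) = 0, Δ (C.cls u hu) = C.cls (C.G₀ u) hGu) ∧
      -- the bracket measures the failure of `Δ` to be a derivation
      (∀ (p : ℤ) (u v : C.Cohomology), u ∈ C.H p →
        br u v = (-1 : ℂ) ^ p •
          (Δ (mul u v) - mul (Δ u) v - (-1 : ℂ) ^ p • mul u (Δ v))) ∧
      IsSupercommutative C.H mul e ∧
      IsBVOperator C.H mul Δ ∧
      IsGerstenhaberBracket C.H mul br ∧
      (∀ (p : ℤ) (u v : C.Cohomology), u ∈ C.H p →
        Δ (br u v) = br (Δ u) v + (-1 : ℂ) ^ (p - 1) • br u (Δ v)) ∧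
      -- `H^0` is a commutative algebra
      (∃ (R : Type u) (_ : CommRing R) (_ : Algebra ℂ R) (φ : R ≃ₗ[ℂ] C.H 0),
        (φ 1 : C.Cohomology) = e ∧
        ∀ x y : R, (φ (x * y) : C.Cohomology) = mul (φ x) (φ y)) ∧
      -- `H^1` is a Lie algebra under the bracket
      (∃ (𝔤 : Type u) (_ : LieRing 𝔤) (_ : LieAlgebra ℂ 𝔤) (ψ : 𝔤 ≃ₗ[ℂ] C.H 1),
        ∀ x y : 𝔤, (ψ ⁅x, y⁆ : C.Cohomology) = br (ψ x) (ψ y)) := by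
  obtain ⟨mul, hmul⟩ := C.exists_wick_cls
  obtain ⟨Δ, hΔ⟩ := C.exists_G₀_cls
  obtain ⟨br, hbr⟩ := exists_bvBracket C.iSupIndep_H C.iSup_H mul Δ
  have hm := TopologicalVOA.isSupercommutative_wick hmul
  have hdeg := TopologicalVOA.map_mem_H hΔ
  have hsq := TopologicalVOA.map_map_eq_zero hΔ
  have hleib := TopologicalVOA.bvDefect_leibniz hmul hΔ
  have hb := isGerstenhaberBracket_of_leibniz hm hdeg hsq hleib hbr
  exact ⟨C.isInternal_H, TopologicalVOA.exists_weightZero_cls, mul, br, Δ, C.cls C.vac C.Q_vac,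
    fun u v hu hv => ⟨_, hmul u v hu hv⟩, ⟨C.Q_vac, rfl⟩, fun u hu h0 => ⟨_, hΔ u hu h0⟩, hbr, hm,
    isBVOperator_of_leibniz hm hdeg hsq hleib, hb, map_bracket_of_bvDefect hdeg hsq hbr,
    hm.exists_commRing, hb.exists_lieAlgebra⟩
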